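/- Let $d\ge 1$, let $S$ be a finite set, and regard $\mathbb Z^d$ as a graph in which $u,v$ are adjacent iff $\|u-v\|_1=1$. For $V\subset\mathbb Z^d$ let $\partial V$ be the set of vertices at graph-distance exactly $1$ from $V$, and let $\Lambda_n=[-n,n]^d\cap\mathbb Z^d$. An $S$-valued random field $X=(X_v)_{v\in\mathbb Z^d}$ is a *Markov random field* if for every finite $V\subset\mathbb Z^d$ the families $(X_v)_{v\in V}$ and $(X_v)_{v\notin V}$ are conditionally independent given $(X_v)_{v\in\partial V}$. It is *ergodic* if its law is translation-invariant and every translation-invariant event has probability $0$ or $1$. Its topological support is $\Omega=\{x\in S^{\mathbb Z^d}:\Pr(X_V=x_V)>0\text{ for all finite }V\}$, we write $\Omega_W=\{\omega_W:\omega\in\Omega\}$ for $W\subset\mathbb Z^d$, and its *specification* is the family of conditional laws $P^\tau_V=\Pr(X_V\in\cdot\mid X_{\partial V}=\tau)$, indexed by the finite $V\subset\mathbb Z^d$ and the $\tau\in\Omega_{\partial V}$. The field $X$ is *ffiid* (a finitary factor of an i.i.d. process) if there are a measurable space $T$, an i.i.d. process $Y=(Y_v)_{v\in\mathbb Z^d}$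 with values in $T$, and a measurable map $\varphi:T^{\mathbb Z^d}\to S^{\mathbb Z^d}$ commuting with all translations such that $\varphi(Y)$ has the same law as $X$ and, for almost every realization $y$ of $Y$, there is a finite $r\ge 0$ such that $\varphi(y')_{\mathbf 0}=\varphi(y)_{\mathbf 0}$ for all $y'\in T^{\mathbb Z^d}$ with $y'_v=y_v$ whenever $\|v\|_1\le r$. **Theorem.** Let $X$ and $X'$ be two ergodic $S$-valued Markov random fields on $\mathbb Z^d$ with distinct laws and with the same specification (hence with the same $\Omega$). Suppose that, for some $\epsilon>0$, $$\inf_{A\subset\Omega_{\partial\Lambda_n}:\ \Pr(X'_{\partial\Lambda_n}\in A)\ge 1-\epsilon}\ \Pr(X_{\partial\Lambda_n}\in A)\ \ge\ e^{-o(n^d)}\qquad\text{as }n\to\infty,$$ that is, there is a function $g$ with $g(n)/n^d\to0$ such that for all sufficiently large $n$ the infimum is at least $e^{-g(n)}$. Then $X$ is not ffiid. -/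

import Mathlib

open MeasureTheory ProbabilityTheory Filter Asymptotics
open scoped Topology

universe u w

/-- Configurations on the lattice `ℤ^d` with values in `S`, with the product σ-algebra. A random
field `X = (X_v)` is represented by its law, a probability measure on this space. -/
abbrev Config (d : ℕ) (S : Type u) : Type u := (Fin d → ℤ) → S

/-- The `ℓ¹` norm on `ℤ^d`; the graph distance of `u` and `v` is `latticeNorm (u - v)`. -/
def latticeNorm {d : ℕ} (v : Fin d → ℤ) : ℕ := ∑ i, (v i).natAbs

/-- `∂V`: the vertices at graph distance exactly `1` from the set `V`. -/
def outerBoundary {d : ℕ} (V : Set (Fin d → ℤ)) : Set (Fin d → ℤ) :=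
  {u | u ∉ V ∧ ∃ v ∈ V, latticeNorm (u - v) = 1}

/-- The box `Λ_n = [-n, n]^d ∩ ℤ^d`. -/
noncomputable def box (d n : ℕ) : Finset (Fin d → ℤ) :=
  Finset.Icc (fun _ => -(n : ℤ)) (fun _ => (n : ℤ))

/-- The translation of configurations by `u`: `(shift u x)_v = x_{v+u}`. -/
def shift {d : ℕ} {S : Type u} (u : Fin d → ℤ) (x : Config d S) : Config d S :=
  fun v => x (v + u)

/-- The law of the random field is not affected by translations. -/
def IsTranslationInvariant {d : ℕ} {S : Type u} [MeasurableSpace S]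
    (μ : Measure (Config d S)) : Prop :=
  ∀ u : Fin d → ℤ, μ.map (shift u) = μ

/-- Translation-invariant, and every translation-invariant event has probability `0` or `1`. -/
def IsErgodicField {d : ℕ} {S : Type u} [MeasurableSpace S]
    (μ : Measure (Config d S)) : Prop :=
  IsTranslationInvariant μ ∧
    ∀ A : Set (Config d S), MeasurableSet A →
      (∀ u : Fin d → ℤ, shift u ⁻¹' A = A) → μ A = 0 ∨ μ A = 1

/-- The restriction `x_W` of a configuration to a set `W` of vertices. -/
def restrictTo {d : ℕ} {S : Type u} (W : Set (Fin d → ℤ)) (x : Config d S) : W → S :=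
  fun v => x v

theorem measurable_restrictTo {d : ℕ} {S : Type u} [MeasurableSpace S]
    (W : Set (Fin d → ℤ)) : Measurable (restrictTo (S := S) W) :=
  measurable_pi_lambda _ fun v => measurable_pi_apply (v : Fin d → ℤ)

/-- Markov random field: for every finite `V`, the families `(X_v)_{v ∈ V}` and
`(X_v)_{v ∉ V}` are conditionally independent given (the σ-algebra generated by)
`(X_v)_{v ∈ ∂V}`. -/
def IsMarkovRandomField {d : ℕ} {S : Type u} [Finite S] [MeasurableSpace S]
    [DiscreteMeasurableSpace S] (μ : Measure (Config d S)) [IsFiniteMeasure μ] : Prop :=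
  ∀ V : Finset (Fin d → ℤ),
    CondIndepFun
      (MeasurableSpace.comap (restrictTo (S := S) (outerBoundary (V : Set (Fin d → ℤ)))) inferInstance)
      (measurable_restrictTo (outerBoundary (V : Set (Fin d → ℤ)))).comap_le
      (restrictTo (S := S) (V : Set (Fin d → ℤ)))
      (restrictTo (S := S) (V : Set (Fin d → ℤ))ᶜ) μ

/-- The topological support `Ω` of the random field: all configurations whose restriction to every
finite set has positive probability. -/
def topSupport {d : ℕ} {S : Type u} [MeasurableSpace S] (μ : Measure (Config d S)) :
    Set (Config d S) :=
  {x | ∀ V : Finset (Fin d → ℤ), 0 < μ {y | ∀ v ∈ V, y v = x v}}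

/-- `Ω_W = {ω_W : ω ∈ Ω}`, the feasible patterns on `W`. -/
def feasible {d : ℕ} {S : Type u} [MeasurableSpace S] (μ : Measure (Config d S))
    (W : Set (Fin d → ℤ)) : Set (W → S) :=
  restrictTo W '' topSupport μ

/-- `P^τ_V`: the conditional law of `X_V` given `X_{∂V} = τ`. -/
noncomputable def specification {d : ℕ} {S : Type u} [MeasurableSpace S]
    (μ : Measure (Config d S)) (V : Finset (Fin d → ℤ))
    (τ : outerBoundary (V : Set (Fin d → ℤ)) → S) : Measure (↥(V : Set (Fin d → ℤ)) → S) :=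
  (cond μ {x | restrictTo (outerBoundary (V : Set (Fin d → ℤ))) x = τ}).map
    (restrictTo (V : Set (Fin d → ℤ)))

/-- Equality of the families `(P^τ_V)`, indexed by the finite sets `V` and `τ ∈ Ω_{∂V}`: the index
sets agree and so do the conditional laws. -/
def SameSpecification {d : ℕ} {S : Type u} [MeasurableSpace S]
    (μ ν : Measure (Config d S)) : Prop :=
  ∀ V : Finset (Fin d → ℤ),
    feasible μ (outerBoundary (V : Set (Fin d → ℤ))) =
        feasible ν (outerBoundary (V : Set (Fin d → ℤ))) ∧
      ∀ τ ∈ feasible μ (outerBoundary (V : Set (Fin d → ℤ))),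
        specification μ V τ = specification ν V τ

/-- A coding from a random field with law `η` to a random field with law `μ`: a measurable
translation-equivariant map which pushes `η` forward to `μ`. -/
structure IsCoding {d : ℕ} {T : Type w} {S : Type u} [MeasurableSpace T] [MeasurableSpace S]
    (φ : Config d T → Config d S) (η : Measure (Config d T)) (μ : Measure (Config d S)) :
    Prop where
  measurable : Measurable φ
  equivariant : ∀ (u : Fin d → ℤ) (y : Config d T), φ (shift u y) = shift u (φ y)
  map_eq : η.map φ = μ

/-- The coding radius `R_φ(y)`: the least `r` such that the value of `φ` at the origin is the same
for all `y'` that coincide with `y` on the `ℓ¹`-ball of radius `r`, and `⊤` if there is none. -/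
noncomputable def codingRadius {d : ℕ} {T : Type w} {S : Type u}
    (φ : Config d T → Config d S) (y : Config d T) : ℕ∞ :=
  sInf {R : ℕ∞ | ∃ r : ℕ, R = (r : ℕ∞) ∧
    ∀ y' : Config d T, (∀ v : Fin d → ℤ, latticeNorm v ≤ r → y' v = y v) → φ y' 0 = φ y 0}

/-- `μ` is (the law of) a finitary factor of the random field with law `η`. -/
def IsFinitaryFactor {d : ℕ} {T : Type w} {S : Type u} [MeasurableSpace T] [MeasurableSpace S]
    (η : Measure (Config d T)) (μ : Measure (Config d S)) : Prop :=
  ∃ φ : Config d T → Config d S, IsCoding φ η μ ∧ ∀ᵐ y ∂η, codingRadius φ y < ⊤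

/-- `μ` is (the law of) a finitary factor of an i.i.d. process, with values in an arbitrary
measurable space `T`. -/
def IsFFIID {d : ℕ} {S : Type u} [MeasurableSpace S] (μ : Measure (Config d S)) : Prop :=
  ∃ (T : Type w) (_ : MeasurableSpace T) (ρ : Measure T) (_ : IsProbabilityMeasure ρ),
    IsFinitaryFactor (Measure.infinitePi (fun _ : Fin d → ℤ => ρ)) μ

/-!
Distinct laws `μ` and `ν` give different probabilities to some event `D` that depends on finitely
many sites; replacing `D` by its complement, `μ D < θ < ν D` for some `θ`. Consider the event `U`
that `D` occurs at more than a fraction `θ` of the sites of the box of radius `n - k`, where `k` is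
so large that `U` depends only on the box `Λ_n`. Its probability under `μ` is estimated in two
ways.

* Under `ν`, by the mean ergodic theorem, `U` has probability close to `1`
  (`IsErgodicField.tendsto_occurrences_le`). Hence the set `A` of boundary conditions on `∂Λ_n`
  under which `U` has conditional probability at least `1 / 2` has `ν`-probability at least
  `1 - ε`. The hypothesis bounds its `μ`-probability from below by `exp (-o(n^d))`, and as the
  conditional probabilities are the same for `μ`, so is `μ U`, up to a factor `2`
  (`SameSpecification.exists_feasible`).
* If `μ` is a finitary factor of an i.i.d. process, then `μ U` is at most `exp (-c n^d)` with
  `c > 0` (`IsFFIID.exists_exp_bound_occurrences`). Indeed, seen from the i.i.d. process, `D` is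
  almost surely decided by a finite window, so it is covered by an event `G` of finite range with
  probability still below `θ` (`exists_local_ae_superset`). Occurrences of `G` at
  sites of the same residue class modulo a large number are independent, and the
  Chernoff bound applies (`exists_exp_bound_occurrences`).

For large `n` the two estimates contradict each other.
-/

/-! ### Boxes and the mean ergodic theorem for `ℤ^d` -/

theorem card_box (d n : ℕ) : (box d n).card = (2 * n + 1) ^ d := by
  simp only [box, Pi.card_Icc, Int.card_Icc, Finset.prod_const, Finset.card_univ,
    Fintype.card_fin]
  congr 1
  omega

theorem mem_box {d n : ℕ} {v : Fin d → ℤ} : v ∈ box d n ↔ ∀ i, (v i).natAbs ≤ n := by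
  simp only [box, Finset.mem_Icc, Pi.le_def, ← forall_and]
  exact forall_congr' fun i => by omega

theorem card_box_pos (d n : ℕ) : 0 < (box d n).card := by
  rw [card_box]; positivity

theorem natAbs_le_latticeNorm {d : ℕ} (v : Fin d → ℤ) (i : Fin d) :
    (v i).natAbs ≤ latticeNorm v :=
  Finset.single_le_sum (f := fun i => (v i).natAbs) (fun _ _ => Nat.zero_le _) (Finset.mem_univ i)

theorem add_mem_box {d m n : ℕ} {u v : Fin d → ℤ} (hu : u ∈ box d m) (hv : v ∈ box d n) :
    u + v ∈ box d (m + n) := by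
  rw [mem_box] at *
  intro i
  have := hu i
  have := hv i
  simp only [Pi.add_apply]
  omega

theorem box_mono {d m n : ℕ} (h : m ≤ n) : box d m ⊆ box d n := fun _ hv =>
  mem_box.2 fun i => (mem_box.1 hv i).trans h

theorem exists_subset_box {d : ℕ} (W : Finset (Fin d → ℤ)) : ∃ k, W ⊆ box d k :=
  ⟨W.sup latticeNorm, fun v hv => mem_box.2 fun i =>
    (natAbs_le_latticeNorm v i).trans (Finset.le_sup (f := latticeNorm) hv)⟩

/-- A shift by at most `k` moves at least the sub-box of radius `n - k` inside the box of
radius `n`, so the sums over the box and over its translate differ in a number of terms that is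
small compared with the volume. -/
theorem norm_sum_box_add_sub_le {d k n : ℕ} {E : Type*} [SeminormedAddCommGroup E]
    (F : (Fin d → ℤ) → E) {C : ℝ} (hF : ∀ v, ‖F v‖ ≤ C) {u : Fin d → ℤ} (hu : u ∈ box d k)
    (hkn : k ≤ n) :
    ‖∑ v ∈ box d n, (F (v + u) - F v)‖ ≤
      2 * (((box d n).card : ℝ) - (box d (n - k)).card) * C := by
  classical
  set B := box d n
  set B' := B.map (addRightEmbedding u)
  have hC : 0 ≤ C := (norm_nonneg _).trans (hF 0)
  have hsub : box d (n - k) ⊆ B ∩ B' := by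
    intro v hv
    refine Finset.mem_inter.2 ⟨box_mono (Nat.sub_le n k) hv, Finset.mem_map.2 ⟨v - u, ?_, ?_⟩⟩
    · have hu' : -u ∈ box d k := by
        rw [mem_box] at *
        simpa using hu
      have := add_mem_box hv hu'
      rwa [Nat.sub_add_cancel hkn, ← sub_eq_add_neg] at this
    · simp
  have hcard : ((box d (n - k)).card : ℝ) ≤ (B ∩ B').card := by
    exact_mod_cast Finset.card_le_card hsub
  have h1 : ∑ v ∈ B, F (v + u) = ∑ v ∈ B', F v := by simp [B']
  have hB' : B'.card = B.card := Finset.card_map _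
  have bound : ∀ s : Finset (Fin d → ℤ), ‖∑ v ∈ s, F v‖ ≤ s.card * C := fun s => by
    simpa using norm_sum_le_of_le s fun v _ => hF v
  rw [Finset.sum_sub_distrib, h1, ← Finset.sum_inter_add_sum_sdiff B' B,
    ← Finset.sum_inter_add_sum_sdiff B B', Finset.inter_comm B' B, add_sub_add_left_eq_sub]
  refine (norm_sub_le _ _).trans ((add_le_add (bound _) (bound _)).trans ?_)
  have e1 : ((B' \ B).card : ℝ) = B.card - (B ∩ B').card := by
    rw [← hB', eq_sub_iff_add_eq, Finset.inter_comm]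
    exact_mod_cast Finset.card_sdiff_add_card_inter B' B
  have e2 : ((B \ B').card : ℝ) = B.card - (B ∩ B').card := by
    rw [eq_sub_iff_add_eq]
    exact_mod_cast Finset.card_sdiff_add_card_inter B B'
  rw [e1, e2, ← add_mul]
  gcongr
  linarith

/-- Boxes are a Følner sequence: shrinking the radius by a constant does not change the volume to
leading order. -/
theorem tendsto_card_box_sub_div (d k : ℕ) :
    Tendsto (fun n : ℕ => ((box d (n - k)).card : ℝ) / (box d n).card) atTop (𝓝 1) := by
  have h : Tendsto (fun n : ℕ => 1 - (2 * k : ℝ) / (2 * n + 1)) atTop (𝓝 1) := by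
    have : Tendsto (fun n : ℕ => (2 * (n : ℝ) + 1)) atTop atTop :=
      tendsto_atTop_add_const_right _ _
        (tendsto_natCast_atTop_atTop.const_mul_atTop (by norm_num))
    simpa using tendsto_const_nhds.sub (this.const_div_atTop (2 * k : ℝ))
  have h2 := h.pow d
  rw [one_pow] at h2
  refine h2.congr' ?_
  filter_upwards [eventually_ge_atTop k] with n hn
  have : (2 * (n : ℝ) + 1) ≠ 0 := by positivity
  rw [card_box, card_box]
  push_cast [Nat.cast_sub hn]
  rw [← div_pow]
  congr 1
  field_simp
  ring

/-- Von Neumann's mean ergodic theorem for an isometric representation of `ℤ^d`. The limit is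
the component of `x` in the orthogonal complement of the coboundaries `U u y - y`; that
complement consists of invariant vectors, and the averages of coboundaries tend to `0`. -/
theorem exists_invariant_tendsto_average {H : Type*} [NormedAddCommGroup H]
    [InnerProductSpace ℝ H] [CompleteSpace H] {d : ℕ} (U : (Fin d → ℤ) → H →ₗᵢ[ℝ] H)
    (hU : ∀ u v x, U u (U v x) = U (u + v) x) (x : H) :
    ∃ p, (∀ u, U u p = p) ∧
      Tendsto (fun n : ℕ => ((box d n).card : ℝ)⁻¹ • ∑ v ∈ box d n, U v x) atTop (𝓝 p) := by
  set V : Submodule ℝ H := Submodule.span ℝ {z | ∃ u y, z = U u y - y}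
  set K := V.topologicalClosure
  have : CompleteSpace K := V.isClosed_topologicalClosure.completeSpace_coe
  set A : ℕ → H → H := fun n y => ((box d n).card : ℝ)⁻¹ • ∑ v ∈ box d n, U v y
  have A_add : ∀ n y z, A n (y + z) = A n y + A n z := fun n y z => by
    simp [A, Finset.sum_add_distrib]
  have A_smul : ∀ n (c : ℝ) y, A n (c • y) = c • A n y := fun n c y => by
    simp only [A, map_smul, ← Finset.smul_sum]
    exact smul_comm _ _ _
  have A_norm : ∀ n y, ‖A n y‖ ≤ ‖y‖ := fun n y => by
    have hpos : (0 : ℝ) < (box d n).card := by exact_mod_cast card_box_pos d n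
    have : ‖∑ v ∈ box d n, U v y‖ ≤ (box d n).card * ‖y‖ := by
      simpa using norm_sum_le_of_le (box d n) fun v _ => ((U v).norm_map y).le
    rw [norm_smul, norm_inv, Real.norm_natCast]
    calc _ ≤ ((box d n).card : ℝ)⁻¹ * ((box d n).card * ‖y‖) := by gcongr
      _ = ‖y‖ := by field_simp
  have A_V : ∀ y ∈ V, Tendsto (A · y) atTop (𝓝 0) := by
    intro y hy
    induction hy using Submodule.span_induction with
    | mem z hz =>
      obtain ⟨u, y, rfl⟩ := hz
      obtain ⟨k, hk⟩ := exists_subset_box {u}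
      have hu : u ∈ box d k := hk (Finset.mem_singleton_self u)
      have hlim : Tendsto (fun n : ℕ =>
          2 * (1 - ((box d (n - k)).card : ℝ) / (box d n).card) * ‖y‖) atTop (𝓝 0) := by
        simpa using ((tendsto_const_nhds (x := (1 : ℝ))).sub
          (tendsto_card_box_sub_div d k)).const_mul 2 |>.mul_const ‖y‖
      refine squeeze_zero_norm' ?_ hlim
      filter_upwards [eventually_ge_atTop k] with n hn
      have hpos : (0 : ℝ) < (box d n).card := by exact_mod_cast card_box_pos d n
      have := norm_sum_box_add_sub_le (fun v => U v y) (fun v => ((U v).norm_map y).le) hu hn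
      simp only [A, map_sub, hU]
      rw [norm_smul, norm_inv, Real.norm_natCast]
      refine (mul_le_mul_of_nonneg_left this (inv_nonneg.2 hpos.le)).trans_eq ?_
      field_simp
    | zero => simp [A]
    | add y z _ _ hy hz => simpa [A_add] using hy.add hz
    | smul c y _ hy => simpa [A_smul] using hy.const_smul c
  have A_K : ∀ y ∈ K, Tendsto (A · y) atTop (𝓝 0) := by
    intro y hy
    rw [Metric.tendsto_atTop]
    intro δ hδ
    obtain ⟨z, hz, hyz⟩ := Metric.mem_closure_iff.1 hy (δ / 2) (by positivity)
    obtain ⟨N, hN⟩ := Metric.tendsto_atTop.1 (A_V z hz) (δ / 2) (by positivity)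
    refine ⟨N, fun n hn => ?_⟩
    have h1 := hN n hn
    rw [dist_zero_right] at h1 ⊢
    rw [dist_eq_norm] at hyz
    calc ‖A n y‖ = ‖A n (y - z) + A n z‖ := by rw [← A_add, sub_add_cancel]
      _ ≤ ‖y - z‖ + ‖A n z‖ := (norm_add_le _ _).trans (by gcongr; exact A_norm _ _)
      _ < δ := by linarith
  obtain ⟨q, hq, p, hp, rfl⟩ := K.exists_add_mem_mem_orthogonal x
  have hinv : ∀ u, U u p = p := by
    intro u
    have h0 : inner ℝ (U u p - p) p = 0 :=
      hp _ (V.le_topologicalClosure (Submodule.subset_span ⟨u, p, rfl⟩))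
    rw [inner_sub_left, real_inner_self_eq_norm_sq] at h0
    have h1 : ‖U u p - p‖ ^ 2 = 0 := by
      rw [norm_sub_sq_real, (U u).norm_map]
      linarith
    exact sub_eq_zero.1 (norm_eq_zero.1 (by simpa using h1))
  refine ⟨p, hinv, ?_⟩
  have hAp : ∀ n, A n p = p := fun n => by
    have hpos : ((box d n).card : ℝ) ≠ 0 := by exact_mod_cast (card_box_pos d n).ne'
    simp only [A, hinv, Finset.sum_const, ← Nat.cast_smul_eq_nsmul ℝ, smul_smul]
    rw [inv_mul_cancel₀ hpos, one_smul]
  have := (A_K q hq).add_const p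
  rw [zero_add] at this
  exact this.congr fun n => by rw [← hAp n, ← A_add, hAp n]

/-! ### The law of large numbers for ergodic fields -/

theorem shift_shift {d : ℕ} {S : Type u} (u v : Fin d → ℤ) (x : Config d S) :
    shift u (shift v x) = shift (u + v) x := by
  funext w
  simp [shift, add_assoc]

theorem measurable_shift {d : ℕ} {S : Type u} [MeasurableSpace S] (u : Fin d → ℤ) :
    Measurable (shift (S := S) u) :=
  measurable_pi_lambda _ fun v => measurable_pi_apply (v + u)

theorem IsTranslationInvariant.measurePreserving {d : ℕ} {S : Type u} [MeasurableSpace S]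
    {μ : Measure (Config d S)} (h : IsTranslationInvariant μ) (u : Fin d → ℤ) :
    MeasurePreserving (shift u) μ μ :=
  ⟨measurable_shift u, h u⟩

/-- The number of sites `v` of the box of radius `n` at which the event `D` occurs, i.e. such that
the configuration seen from `v` belongs to `D`. It is real valued, as it enters averages. -/
noncomputable def occurrences {d : ℕ} {S : Type u} (D : Set (Config d S)) (n : ℕ)
    (x : Config d S) : ℝ :=
  ∑ v ∈ box d n, D.indicator 1 (shift v x)

theorem measurable_occurrences {d : ℕ} {S : Type u} [MeasurableSpace S] {D : Set (Config d S)}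
    (hD : MeasurableSet D) (n : ℕ) : Measurable (occurrences D n) :=
  Finset.measurable_sum _ fun v _ => (measurable_one.indicator hD).comp (measurable_shift v)

/-- Ergodicity is stated for strictly invariant events; an almost invariant event agrees almost
everywhere with the intersection of its countably many translates, which is strictly invariant. -/
theorem IsErgodicField.ae_mem_or_ae_notMem {d : ℕ} {S : Type u} [MeasurableSpace S]
    {μ : Measure (Config d S)} [IsProbabilityMeasure μ] (h : IsErgodicField μ)
    {B : Set (Config d S)} (hB : MeasurableSet B)
    (hinv : ∀ u : Fin d → ℤ, shift u ⁻¹' B =ᵐ[μ] B) :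
    (∀ᵐ x ∂μ, x ∈ B) ∨ ∀ᵐ x ∂μ, x ∉ B := by
  set B' := ⋂ u : Fin d → ℤ, shift u ⁻¹' B
  have hB' : MeasurableSet B' := MeasurableSet.iInter fun u => measurable_shift u hB
  have hB'inv : ∀ u : Fin d → ℤ, shift u ⁻¹' B' = B' := by
    intro u
    ext x
    simp only [B', Set.mem_preimage, Set.mem_iInter, shift_shift]
    exact ⟨fun hx v => by simpa using hx (v - u), fun hx v => hx _⟩
  have hae : ∀ᵐ x ∂μ, x ∈ B' ↔ x ∈ B := by
    filter_upwards [ae_all_iff.2 fun u => (hinv u).mem_iff] with x hx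
    exact Set.mem_iInter.trans ⟨fun hx' => (hx 0).1 (hx' 0), fun hx' u => (hx u).2 hx'⟩
  rcases h.2 B' hB' hB'inv with h0 | h1
  · right
    filter_upwards [hae, measure_eq_zero_iff_ae_notMem.1 h0] with x hx hx'
    rwa [← hx]
  · left
    filter_upwards [hae, (mem_ae_iff_prob_eq_one hB').2 h1] with x hx hx'
    rwa [← hx]

theorem IsErgodicField.ae_eq_const {d : ℕ} {S : Type u} [MeasurableSpace S]
    {μ : Measure (Config d S)} [IsProbabilityMeasure μ] (h : IsErgodicField μ)
    {f : Config d S → ℝ} (hf : Measurable f)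
    (hinv : ∀ u : Fin d → ℤ, f ∘ shift u =ᵐ[μ] f) : ∃ c, f =ᵐ[μ] Function.const _ c := by
  refine Filter.exists_eventuallyEq_const_of_forall_separating MeasurableSet fun U hU => ?_
  refine h.ae_mem_or_ae_notMem (B := f ⁻¹' U) (hf hU) fun u => ?_
  refine ((hinv u).mono fun x hx => ?_).set_eq
  simp only [Set.mem_preimage]
  rw [← hx, Function.comp_apply]

/-- The mean ergodic theorem for an ergodic field, in the form of a law of large numbers: with
probability tending to `1`, the frequency of an event in a large box exceeds any number below the
probability of the event. -/
theorem IsErgodicField.tendsto_occurrences_le {d : ℕ} {S : Type u} [MeasurableSpace S]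
    {μ : Measure (Config d S)} [IsProbabilityMeasure μ] (h : IsErgodicField μ)
    {D : Set (Config d S)} (hD : MeasurableSet D) {θ : ℝ} (hθ : θ < μ.real D) :
    Tendsto (fun n => μ {x | occurrences D n x ≤ θ * (box d n).card}) atTop (𝓝 0) := by
  let U : (Fin d → ℤ) → Lp ℝ 2 μ →ₗᵢ[ℝ] Lp ℝ 2 μ := fun u =>
    Lp.compMeasurePreservingₗᵢ ℝ (shift u) (h.1.measurePreserving u)
  have hUcoe : ∀ u f, U u f =ᵐ[μ] f ∘ shift u := fun u f => Lp.coeFn_compMeasurePreserving f _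
  have hU : ∀ u v f, U u (U v f) = U (u + v) f := by
    intro u v f
    refine Lp.ext ?_
    have h1 : U v f ∘ shift u =ᵐ[μ] (f ∘ shift v) ∘ shift u :=
      (h.1.measurePreserving u).quasiMeasurePreserving.ae_eq_comp (hUcoe v f)
    refine ((hUcoe u _).trans h1).trans (Filter.EventuallyEq.trans ?_ (hUcoe (u + v) f).symm)
    refine Filter.Eventually.of_forall fun x => ?_
    simp only [Function.comp_apply, shift_shift, add_comm]
  set F : Lp ℝ 2 μ := indicatorConstLp 2 hD (measure_ne_top μ D) (1 : ℝ)
  have hF : F =ᵐ[μ] D.indicator 1 := indicatorConstLp_coeFn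
  obtain ⟨p, hp, hlim⟩ := exists_invariant_tendsto_average U hU F
  have hAcoe : ∀ n, (((box d n).card : ℝ)⁻¹ • ∑ v ∈ box d n, U v F : Lp ℝ 2 μ) =ᵐ[μ]
      fun x => ((box d n).card : ℝ)⁻¹ * occurrences D n x := by
    intro n
    have h1 : ∀ v, U v F =ᵐ[μ] fun x => D.indicator 1 (shift v x) := fun v =>
      (hUcoe v F).trans ((h.1.measurePreserving v).quasiMeasurePreserving.ae_eq_comp hF)
    filter_upwards [Lp.coeFn_smul ((box d n).card : ℝ)⁻¹ (∑ v ∈ box d n, U v F),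
      Lp.coeFn_finsetSum (box d n) (fun v => U v F), ae_all_iff.2 h1] with x hx1 hx2 hx3
    rw [hx1, Pi.smul_apply, hx2, smul_eq_mul, occurrences]
    congr 1
    simp only [Finset.sum_apply]
    exact Finset.sum_congr rfl fun v _ => hx3 v
  obtain ⟨c, hc⟩ : ∃ c, p =ᵐ[μ] Function.const _ c := by
    refine h.ae_eq_const (Lp.stronglyMeasurable p).measurable fun u => ?_
    have := hUcoe u p
    rw [hp] at this
    exact this.symm
  -- The limit has the same integral as each of the averages, which identifies the constant.
  have hcD : c = μ.real D := by
    have hint : ∀ f : Lp ℝ 2 μ, inner ℝ (indicatorConstLp 2 MeasurableSet.univ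
        (measure_ne_top μ _) (1 : ℝ)) f = ∫ x, f x ∂μ := fun f => by
      rw [L2.inner_indicatorConstLp_one]
      simp
    have h1 : ∀ n : ℕ, ∫ x, (((box d n).card : ℝ)⁻¹ • ∑ v ∈ box d n, U v F : Lp ℝ 2 μ) x ∂μ
        = μ.real D := by
      intro n
      have hpos : ((box d n).card : ℝ) ≠ 0 := by exact_mod_cast (card_box_pos d n).ne'
      have h2 : ∀ v, ∫ x, D.indicator (1 : Config d S → ℝ) (shift v x) ∂μ = μ.real D := by
        intro v
        have h3 := integral_map (μ := μ) (measurable_shift v).aemeasurable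
          (f := D.indicator (1 : Config d S → ℝ))
          (measurable_one.indicator hD).aestronglyMeasurable
        rw [← h3, h.1 v, integral_indicator_one hD]
      rw [integral_congr_ae (hAcoe n), integral_const_mul]
      simp only [occurrences]
      rw [integral_finsetSum]
      · simp only [h2, Finset.sum_const, nsmul_eq_mul]
        field_simp
      · intro v _
        exact (h.1.measurePreserving v).integrable_comp_of_integrable
          ((integrable_const (1 : ℝ)).indicator hD)
    have h4 := (tendsto_const_nhds (x := (indicatorConstLp 2 MeasurableSet.univ
        (measure_ne_top μ _) (1 : ℝ) : Lp ℝ 2 μ))).inner (𝕜 := ℝ) hlim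
    simp only [hint, h1] at h4
    rw [tendsto_nhds_unique tendsto_const_nhds h4, integral_congr_ae hc]
    simp
  have hmeas := tendstoInMeasure_of_tendsto_Lp hlim (ENNReal.ofReal (μ.real D - θ))
    (by simpa using hθ)
  refine tendsto_of_tendsto_of_tendsto_of_le_of_le tendsto_const_nhds hmeas
    (fun _ => zero_le) fun n => measure_mono_ae ?_
  filter_upwards [hAcoe n, hc] with x hx1 hx2 hx
  change ENNReal.ofReal _ ≤ edist _ _
  have hpos : (0 : ℝ) < (box d n).card := by exact_mod_cast card_box_pos d n
  rw [hx1, hx2, edist_dist, Real.dist_eq, Function.const_apply, hcD]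
  refine ENNReal.ofReal_le_ofReal (le_trans ?_ (neg_le_abs _))
  have : ((box d n).card : ℝ)⁻¹ * occurrences D n x ≤ θ := by
    rw [inv_mul_le_iff₀ hpos, mul_comm]
    exact hx
  linarith

/-! ### Concentration for events of finite range in an i.i.d. process -/

/-- The law of an i.i.d. process on `ℤ^d` whose entries have law `ρ`. -/
noncomputable abbrev iidLaw (d : ℕ) {T : Type w} [MeasurableSpace T] (ρ : Measure T) :
    Measure (Config d T) :=
  Measure.infinitePi fun _ => ρ

open Classical in
/-- The configuration that is given by the first entry on `A` and by the second one off `A`. -/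
noncomputable def glue {d : ℕ} {T : Type w} (A : Set (Fin d → ℤ))
    (p : Config d T × Config d T) : Config d T :=
  fun v => if v ∈ A then p.1 v else p.2 v

theorem measurable_glue {d : ℕ} {T : Type w} [MeasurableSpace T] (A : Set (Fin d → ℤ)) :
    Measurable (glue (T := T) A) := by
  refine measurable_pi_lambda _ fun v => ?_
  by_cases hv : v ∈ A
  · simp only [glue, hv, if_true]
    exact (measurable_pi_apply v).comp measurable_fst
  · simp only [glue, hv, if_false]
    exact (measurable_pi_apply v).comp measurable_snd

section IID

variable {d : ℕ} {T : Type w} [MeasurableSpace T] (ρ : Measure T) [IsProbabilityMeasure ρ]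

/-- Gluing two independent copies of an i.i.d. process gives an i.i.d. process. -/
theorem map_glue_prod_iidLaw (A : Set (Fin d → ℤ)) :
    ((iidLaw d ρ).prod (iidLaw d ρ)).map (glue A) = iidLaw d ρ := by
  classical
  refine Measure.eq_infinitePi _ fun s t ht => ?_
  have hpre : glue A ⁻¹' (Set.pi (s : Set (Fin d → ℤ)) t) =
      (Set.pi ((s.filter (· ∈ A) : Finset (Fin d → ℤ)) : Set (Fin d → ℤ)) t) ×ˢ
        (Set.pi ((s.filter (· ∉ A) : Finset (Fin d → ℤ)) : Set (Fin d → ℤ)) t) := by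
    ext p
    simp only [Set.mem_preimage, Set.mem_pi, Finset.mem_coe, Set.mem_prod, Finset.mem_filter, glue]
    constructor
    · intro h
      exact ⟨fun v hv => by simpa [hv.2] using h v hv.1,
        fun v hv => by simpa [hv.2] using h v hv.1⟩
    · rintro ⟨h1, h2⟩ v hv
      by_cases hvA : v ∈ A
      · simpa [hvA] using h1 v ⟨hv, hvA⟩
      · simpa [hvA] using h2 v ⟨hv, hvA⟩
  rw [Measure.map_apply (measurable_glue A) (MeasurableSet.pi s.countable_toSet fun i _ => ht i),
    hpre, Measure.prod_prod, Measure.infinitePi_pi _ fun i _ => ht i,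
    Measure.infinitePi_pi _ fun i _ => ht i]
  exact Finset.prod_filter_mul_prod_filter_not s (· ∈ A) fun i => ρ (t i)

theorem isTranslationInvariant_iidLaw : IsTranslationInvariant (iidLaw d ρ) := by
  classical
  intro u
  refine Measure.eq_infinitePi _ fun s t ht => ?_
  have hpre : shift u ⁻¹' (Set.pi (s : Set (Fin d → ℤ)) t) =
      Set.pi ((s.map (addRightEmbedding u) : Finset (Fin d → ℤ)) : Set (Fin d → ℤ))
        fun v => t (v - u) := by
    ext x
    simp only [Set.mem_preimage, Set.mem_pi, Finset.mem_coe, Finset.mem_map,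
      addRightEmbedding_apply, shift]
    constructor
    · rintro h _ ⟨v, hv, rfl⟩
      simpa using h v hv
    · intro h v hv
      simpa using h (v + u) ⟨v, hv, rfl⟩
  rw [Measure.map_apply (measurable_shift u) (MeasurableSet.pi s.countable_toSet fun i _ => ht i),
    hpre, Measure.infinitePi_pi _ fun i _ => ht _]
  simp

/-- Functions of disjoint sets of coordinates of an i.i.d. process are uncorrelated. -/
theorem lintegral_mul_of_dependsOn {A : Set (Fin d → ℤ)} {f g : Config d T → ENNReal}
    (hf : Measurable f) (hg : Measurable g) (hfA : DependsOn f A) (hgA : DependsOn g Aᶜ) :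
    ∫⁻ y, f y * g y ∂iidLaw d ρ = (∫⁻ y, f y ∂iidLaw d ρ) * ∫⁻ y, g y ∂iidLaw d ρ := by
  have h1 : ∀ p : Config d T × Config d T, f (glue A p) = f p.1 := fun p =>
    hfA fun v hv => by simp [glue, hv]
  have h2 : ∀ p : Config d T × Config d T, g (glue A p) = g p.2 := fun p =>
    hgA fun v hv => by simp [glue, show v ∉ A from hv]
  conv_lhs => rw [← map_glue_prod_iidLaw ρ A]
  rw [lintegral_map (f := fun y => f y * g y) (hf.mul hg) (measurable_glue A)]
  simp only [h1, h2]
  exact lintegral_prod_mul hf.aemeasurable hg.aemeasurable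

theorem lintegral_prod_shift {B : Set (Fin d → ℤ)} {h : Config d T → ENNReal} (hh : Measurable h)
    (hB : DependsOn h B) (C : Finset (Fin d → ℤ))
    (hC : ∀ v ∈ C, ∀ w ∈ C, ∀ a ∈ B, ∀ b ∈ B, a + v = b + w → v = w) :
    ∫⁻ y, ∏ v ∈ C, h (shift v y) ∂iidLaw d ρ = (∫⁻ y, h y ∂iidLaw d ρ) ^ C.card := by
  classical
  induction C using Finset.induction_on with
  | empty => simp
  | insert v C hv ih =>
    have hdep : ∀ w, DependsOn (fun y => h (shift w y)) ((· + w) '' B) := fun w y y' hyy' =>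
      hB fun b hb => hyy' _ ⟨b, hb, rfl⟩
    have hmeas : ∀ w : Fin d → ℤ, Measurable fun y : Config d T => h (shift w y) := fun w =>
      hh.comp (measurable_shift w)
    have hrest : DependsOn (fun y => ∏ w ∈ C, h (shift w y)) ((· + v) '' B)ᶜ := by
      intro y y' hyy'
      refine Finset.prod_congr rfl fun w hw => hB fun b hb => hyy' _ ?_
      rintro ⟨a, ha, hab⟩
      have := hC v (Finset.mem_insert_self v C) w (Finset.mem_insert_of_mem hw) a ha b hb hab
      exact hv (this ▸ hw)
    simp only [Finset.prod_insert hv]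
    rw [lintegral_mul_of_dependsOn ρ (hmeas v) (Finset.measurable_fun_prod _ fun w _ => hmeas w)
      (hdep v) hrest, ih fun w hw w' hw' => hC w (Finset.mem_insert_of_mem hw) w'
        (Finset.mem_insert_of_mem hw'), Finset.card_insert_of_notMem hv, pow_succ']
    congr 1
    rw [← lintegral_map hh (measurable_shift v), isTranslationInvariant_iidLaw ρ v]

/-- Sites in the same residue class modulo `2 R + 1` have disjoint neighbourhoods of radius
`R`. -/
theorem eq_of_add_eq_add_of_intCast_eq {R : ℕ} {v w a b : Fin d → ℤ} (ha : a ∈ box d R)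
    (hb : b ∈ box d R) (hab : a + v = b + w)
    (hvw : (fun i => (v i : ZMod (2 * R + 1))) = fun i => (w i : ZMod (2 * R + 1))) : v = w := by
  funext i
  have h1 := congrFun hvw i
  rw [ZMod.intCast_eq_intCast_iff_dvd_sub] at h1
  have h2 := congrFun hab i
  have h3 := mem_box.1 ha i
  have h4 := mem_box.1 hb i
  simp only [Pi.add_apply] at h2
  have h5 : w i - v i = 0 := Int.eq_zero_of_abs_lt_dvd h1 (by
    rw [abs_lt]
    push_cast
    omega)
  omega

/-- Bound on an exponential moment for a stationary field of range `R`. The sites are split into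
`(2 R + 1) ^ d` residue classes. Within one class the summands are independent, and the
convexity of the exponential separates the classes. -/
theorem lintegral_exp_sum_le_one {R : ℕ} {f : Config d T → ℝ} (hf : Measurable f)
    (hR : DependsOn f (box d R : Set (Fin d → ℤ)))
    (hexp : ∫⁻ y, ENNReal.ofReal (Real.exp (f y)) ∂iidLaw d ρ ≤ 1) (n : ℕ) :
    ∫⁻ y, ENNReal.ofReal (Real.exp
      ((((2 * R + 1 : ℕ) : ℝ) ^ d)⁻¹ * ∑ v ∈ box d n, f (shift v y))) ∂iidLaw d ρ ≤ 1 := by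
  classical
  set L := 2 * R + 1
  set c : (Fin d → ℤ) → (Fin d → ZMod L) := fun v i => (v i : ZMod L)
  set K : ℝ := (L : ℝ) ^ d
  have hK : 0 < K := by positivity
  have hcard : (Fintype.card (Fin d → ZMod L) : ℝ) = K := by
    simp [K, ZMod.card]
  set h : Config d T → ENNReal := fun y => ENNReal.ofReal (Real.exp (f y))
  have hh : Measurable h := ENNReal.measurable_ofReal.comp (Real.measurable_exp.comp hf)
  have hhR : DependsOn h (box d R : Set (Fin d → ℤ)) := fun y y' hyy' => by
    simp only [h, hR hyy']
  have key : ∀ y : Config d T,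
      ENNReal.ofReal (Real.exp (K⁻¹ * ∑ v ∈ box d n, f (shift v y))) ≤
        ∑ j : Fin d → ZMod L, ENNReal.ofReal K⁻¹ * ∏ v ∈ box d n with c v = j, h (shift v y) := by
    intro y
    have h1 : ∀ j, ∏ v ∈ box d n with c v = j, h (shift v y) =
        ENNReal.ofReal (Real.exp (∑ v ∈ box d n with c v = j, f (shift v y))) := fun j => by
      rw [Real.exp_sum, ENNReal.ofReal_prod_of_nonneg fun _ _ => (Real.exp_pos _).le]
    simp only [h1, ← ENNReal.ofReal_mul (inv_nonneg.2 hK.le)]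
    rw [← ENNReal.ofReal_sum_of_nonneg fun _ _ => by positivity]
    refine ENNReal.ofReal_le_ofReal ?_
    rw [← Finset.sum_fiberwise (box d n) c, Finset.mul_sum]
    have := convexOn_exp.map_sum_le (t := Finset.univ) (w := fun _ : Fin d → ZMod L => K⁻¹)
      (p := fun j => ∑ v ∈ box d n with c v = j, f (shift v y)) (fun _ _ => by positivity)
      (by rw [Finset.sum_const, Finset.card_univ, nsmul_eq_mul, hcard, mul_inv_cancel₀ hK.ne'])
      (fun _ _ => Set.mem_univ _)
    simpa only [smul_eq_mul] using this
  have hmeas : ∀ j, Measurable fun y : Config d T =>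
      ∏ v ∈ box d n with c v = j, h (shift v y) := fun j =>
    Finset.measurable_fun_prod _ fun v _ => hh.comp (measurable_shift v)
  refine (lintegral_mono key).trans ?_
  rw [lintegral_finsetSum _ fun j _ => (hmeas j).const_mul _]
  have hclass : ∀ j, ∫⁻ y, ENNReal.ofReal K⁻¹ * ∏ v ∈ box d n with c v = j, h (shift v y)
      ∂iidLaw d ρ ≤ ENNReal.ofReal K⁻¹ := by
    intro j
    rw [lintegral_const_mul _ (hmeas j), lintegral_prod_shift ρ hh hhR]
    · exact mul_le_of_le_one_right' (pow_le_one' hexp _)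
    · intro v hv w hw a ha b hb hab
      rw [Finset.mem_filter] at hv hw
      exact eq_of_add_eq_add_of_intCast_eq ha hb hab (hv.2.trans hw.2.symm)
  refine (Finset.sum_le_sum fun j _ => hclass j).trans ?_
  rw [Finset.sum_const, Finset.card_univ, nsmul_eq_mul, ← ENNReal.ofReal_natCast, hcard,
    ← ENNReal.ofReal_mul hK.le, mul_inv_cancel₀ hK.ne', ENNReal.ofReal_one]

/-- For an event that depends on finitely many coordinates of an i.i.d. process, the probability
that its frequency in a box exceeds its probability by a fixed amount is exponentially small in
the volume. -/
theorem exists_exp_bound_occurrences {R : ℕ} {G : Set (Config d T)} (hG : MeasurableSet G)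
    (hR : DependsOn (· ∈ G) (box d R : Set (Fin d → ℤ))) {θ : ℝ}
    (hθ : (iidLaw d ρ).real G < θ) :
    ∃ c : ℝ, 0 < c ∧ ∀ n, iidLaw d ρ {y | θ * (box d n).card ≤ occurrences G n y} ≤
      ENNReal.ofReal (Real.exp (-(c * (box d n).card))) := by
  set π := (iidLaw d ρ).real G
  have hπ0 : 0 ≤ π := measureReal_nonneg
  have hπ1 : π ≤ 1 := measureReal_le_one
  -- The exponent `s θ - ψ` is positive for small `s`; the value of `s` makes it at least `s ^ 2`.
  obtain ⟨s, hs0, hs1, hsθ⟩ : ∃ s : ℝ, 0 < s ∧ s ≤ 1 ∧ 2 * s ≤ θ - π := by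
    refine ⟨min 1 ((θ - π) / 2), lt_min one_pos (by linarith), min_le_left _ _, ?_⟩
    have := min_le_right 1 ((θ - π) / 2)
    linarith
  set ψ := π * (s + s ^ 2)
  set f : Config d T → ℝ := fun y => s * G.indicator 1 y - ψ
  have hind : Measurable (G.indicator (1 : Config d T → ℝ)) := measurable_one.indicator hG
  have hf : Measurable f := (hind.const_mul s).sub_const ψ
  have hfR : DependsOn f (box d R : Set (Fin d → ℤ)) := fun y y' hyy' => by
    classical
    have : (y ∈ G) = (y' ∈ G) := hR hyy'
    simp only [f, Set.indicator_apply, this, Pi.one_apply]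
  have hexp : ∫⁻ y, ENNReal.ofReal (Real.exp (f y)) ∂iidLaw d ρ ≤ 1 := by
    have h1 : ∀ y, ENNReal.ofReal (Real.exp (f y)) =
        G.indicator (fun _ => ENNReal.ofReal (Real.exp (s - ψ))) y +
          Gᶜ.indicator (fun _ => ENNReal.ofReal (Real.exp (-ψ))) y := by
      intro y
      by_cases hy : y ∈ G <;> simp [f, hy]
    simp only [h1]
    rw [lintegral_add_left (measurable_const.indicator hG), lintegral_indicator_const hG,
      lintegral_indicator_const hG.compl, ← ofReal_measureReal, ← ofReal_measureReal,
      probReal_compl_eq_one_sub hG, ← ENNReal.ofReal_mul (Real.exp_pos _).le,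
      ← ENNReal.ofReal_mul (Real.exp_pos _).le,
      ← ENNReal.ofReal_add (mul_nonneg (Real.exp_pos _).le hπ0)
        (mul_nonneg (Real.exp_pos _).le (sub_nonneg.2 hπ1)), ← ENNReal.ofReal_one]
    refine ENNReal.ofReal_le_ofReal ?_
    have h2 : Real.exp s ≤ 1 + s + s ^ 2 := by
      have := (abs_le.1 (Real.abs_exp_sub_one_sub_id_le (abs_le.2 ⟨by linarith, hs1⟩))).2
      linarith
    have h3 : 1 + ψ ≤ Real.exp ψ := by linarith [Real.add_one_le_exp ψ]
    have h4 : Real.exp s * π + (1 - π) ≤ Real.exp ψ := by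
      refine le_trans ?_ h3
      have := mul_le_mul_of_nonneg_right h2 hπ0
      simp only [ψ]
      linarith
    calc Real.exp (s - ψ) * π + Real.exp (-ψ) * (1 - π)
        = Real.exp (-ψ) * (Real.exp s * π + (1 - π)) := by
          rw [sub_eq_add_neg, Real.exp_add]; ring
      _ ≤ Real.exp (-ψ) * Real.exp ψ := by gcongr
      _ = 1 := by rw [← Real.exp_add]; simp
  set K : ℝ := ((2 * R + 1 : ℕ) : ℝ) ^ d
  have hK : 0 < K := by positivity
  have hpos : 0 < s * θ - ψ := by
    simp only [ψ]
    nlinarith [mul_le_mul_of_nonneg_right hπ1 (sq_nonneg s), mul_le_mul_of_nonneg_left hsθ hs0.le,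
      mul_pos hs0 hs0]
  refine ⟨K⁻¹ * (s * θ - ψ), by positivity, fun n => ?_⟩
  set c := K⁻¹ * (s * θ - ψ)
  have h1 := lintegral_exp_sum_le_one ρ hf hfR hexp n
  have h2 : Measurable fun y : Config d T =>
      ENNReal.ofReal (Real.exp (K⁻¹ * ∑ v ∈ box d n, f (shift v y))) :=
    ENNReal.measurable_ofReal.comp (Real.measurable_exp.comp
      ((Finset.measurable_fun_sum _ fun v _ => hf.comp (measurable_shift v)).const_mul _))
  have h3 := mul_meas_ge_le_lintegral (μ := iidLaw d ρ) h2
    (ENNReal.ofReal (Real.exp (c * (box d n).card)))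
  have hsub : {y : Config d T | θ * (box d n).card ≤ occurrences G n y} ⊆
      {y | ENNReal.ofReal (Real.exp (c * (box d n).card)) ≤
        ENNReal.ofReal (Real.exp (K⁻¹ * ∑ v ∈ box d n, f (shift v y)))} := by
    intro y hy
    refine ENNReal.ofReal_le_ofReal (Real.exp_le_exp.2 ?_)
    have : ∑ v ∈ box d n, f (shift v y) = s * occurrences G n y - ψ * (box d n).card := by
      simp only [f, occurrences, Finset.sum_sub_distrib, Finset.mul_sum, Finset.sum_const,
        nsmul_eq_mul]
      ring
    rw [this]
    simp only [c, mul_assoc]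
    refine mul_le_mul_of_nonneg_left ?_ (inv_nonneg.2 hK.le)
    have := mul_le_mul_of_nonneg_left (Set.mem_ofPred.1 hy) hs0.le
    linarith
  have h4 : ENNReal.ofReal (Real.exp (c * (box d n).card)) *
      iidLaw d ρ {y | θ * (box d n).card ≤ occurrences G n y} ≤ 1 :=
    (mul_le_mul_right (measure_mono hsub) _).trans (h3.trans h1)
  rw [Real.exp_neg, ENNReal.ofReal_inv_of_pos (Real.exp_pos _), ENNReal.le_inv_iff_mul_le, mul_comm]
  exact h4

end IID

/-! ### Concentration for finitary factors of an i.i.d. process -/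

/-- If a function of an i.i.d. process has, at almost every realization, a finite window that
determines whether its event `E` occurs, then `E` is covered, up to a null set, by an event `G`
that depends on finitely many coordinates and is hardly more likely.

Here `G` is the event that, given the coordinates in a box, `E` has positive conditional
probability. By Fubini's theorem it is measurable, unlike the event that some continuation of the
coordinates in the box belongs to `E`, which in a general measurable space need not be so. -/
theorem exists_local_ae_superset {d : ℕ} {T : Type w} [MeasurableSpace T] (ρ : Measure T)
    [IsProbabilityMeasure ρ] {E : Set (Config d T)} (hE : MeasurableSet E)
    (hfin : ∀ᵐ y ∂iidLaw d ρ, ∃ R : ℕ, ∀ y' : Config d T,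
      (∀ v ∈ box d R, y' v = y v) → (y' ∈ E ↔ y ∈ E))
    {δ : ℝ} (hδ : (iidLaw d ρ).real E < δ) :
    ∃ (R : ℕ) (G : Set (Config d T)), MeasurableSet G ∧
      DependsOn (· ∈ G) (box d R : Set (Fin d → ℤ)) ∧ (∀ᵐ y ∂iidLaw d ρ, y ∈ E → y ∈ G) ∧
      (iidLaw d ρ).real G < δ := by
  set η := iidLaw d ρ
  let g : ℕ → Config d T × Config d T → Config d T := fun R =>
    glue (box d R : Set (Fin d → ℤ))
  have hg : ∀ R, MeasurableSet (g R ⁻¹' E) := fun R => measurable_glue _ hE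
  let G : ℕ → Set (Config d T) := fun R => {y | η (Prod.mk y ⁻¹' (g R ⁻¹' E)) ≠ 0}
  have hG : ∀ R, MeasurableSet (G R) := fun R =>
    (measurable_measure_prodMk_left (hg R)) (measurableSet_singleton 0).compl
  have hGR : ∀ R, DependsOn (· ∈ G R) (box d R : Set (Fin d → ℤ)) := by
    intro R y y' hyy'
    have : ∀ z, g R (y, z) = g R (y', z) := fun z => by
      funext v
      by_cases hv : v ∈ (box d R : Set (Fin d → ℤ))
      · simpa [g, glue, show v ∈ box d R from hv] using hyy' v hv
      · simp [g, glue, show v ∉ box d R from hv]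
    simp only [G, Set.mem_ofPred_eq, Set.preimage, this]
  have hEG : ∀ R, ∀ᵐ y ∂η, y ∈ E → y ∈ G R := by
    intro R
    have hnull : η (E \ G R) = 0 := by
      have h1 : MeasurableSet (g R ⁻¹' (E \ G R)) := measurable_glue _ (hE.diff (hG R))
      have hglue : (η.prod η).map (g R) = η := map_glue_prod_iidLaw ρ _
      rw [← hglue, Measure.map_apply (measurable_glue _) (hE.diff (hG R)),
        Measure.measure_prod_null h1]
      refine Filter.Eventually.of_forall fun y => ?_
      have h2 : ∀ z, (g R (y, z) ∈ G R ↔ y ∈ G R) := fun z =>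
        (hGR R fun v hv => by simp [g, glue, show v ∈ box d R from hv]).to_iff
      by_cases hy : y ∈ G R
      · refine measure_mono_null (fun z hz => ?_) (measure_empty (μ := η))
        exact hz.2 ((h2 z).2 hy)
      · exact measure_mono_null (fun z hz => hz.1) (not_not.1 hy)
    filter_upwards [measure_eq_zero_iff_ae_notMem.1 hnull] with y hy hyE
    by_contra hyG
    exact hy ⟨hyE, hyG⟩
  -- The (possibly non-measurable) events that the window of radius `R` decides about `E`.
  let Q : ℕ → Set (Config d T) := fun R => {y | ∀ y' : Config d T,
      (∀ v ∈ box d R, y' v = y v) → (y' ∈ E ↔ y ∈ E)}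
  have hQmono : Monotone Q := fun R R' hRR' y hy y' hy' =>
    hy y' fun v hv => hy' v (box_mono hRR' hv)
  have hQ : Tendsto (fun R => η (Q R)) atTop (𝓝 1) := by
    have h1 : η (⋃ R, Q R) = 1 := by
      rw [← measure_univ (μ := η)]
      exact measure_congr (Filter.eventuallyEq_univ.2
        (hfin.mono fun y hy => Set.mem_iUnion.2 hy))
    rw [← h1]
    exact tendsto_measure_iUnion_atTop hQmono
  have hδ' : (1 - ENNReal.ofReal (δ - η.real E)) < 1 :=
    ENNReal.sub_lt_self ENNReal.one_ne_top one_ne_zero (by simpa using hδ)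
  obtain ⟨R, hR⟩ := (hQ.eventually (lt_mem_nhds hδ')).exists
  refine ⟨R, G R, hG R, hGR R, hEG R, ?_⟩
  have hsub : Q R ⊆ (G R \ E)ᶜ := by
    rintro y hy ⟨hyG, hyE⟩
    obtain ⟨z, hz⟩ := nonempty_of_measure_ne_zero hyG
    exact hyE ((hy (g R (y, z)) fun v hv => by simp [g, glue, hv]).1 hz)
  have hdiff : η.real (G R \ E) < δ - η.real E := by
    have hm : MeasurableSet (G R \ E) := (hG R).diff hE
    have h1 : 1 - ENNReal.ofReal (δ - η.real E) < 1 - η (G R \ E) := by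
      rw [← prob_compl_eq_one_sub hm]
      exact hR.trans_le (measure_mono hsub)
    have h2 : η (G R \ E) < ENNReal.ofReal (δ - η.real E) := by
      by_contra hcon
      exact h1.not_ge (tsub_le_tsub_left (not_lt.1 hcon) 1)
    exact (ENNReal.lt_ofReal_iff_toReal_lt (measure_ne_top _ _)).1 h2
  have hle : η.real (G R) ≤ η.real E + η.real (G R \ E) :=
    (measureReal_mono (Set.subset_union_right.trans Set.union_sdiff_self.symm.subset)).trans
      (measureReal_union_le _ _)
  linarith

theorem exists_of_codingRadius_lt_top {d : ℕ} {T : Type w} {S : Type u}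
    {φ : Config d T → Config d S} {y : Config d T} (h : codingRadius φ y < ⊤) :
    ∃ r : ℕ, ∀ y' : Config d T, (∀ v, latticeNorm v ≤ r → y' v = y v) → φ y' 0 = φ y 0 := by
  obtain ⟨_, ⟨r, -, hr⟩, -⟩ := sInf_lt_iff.1 h
  exact ⟨r, hr⟩

/-- Pulling a local event back along a coding of finite radius gives an event that is decided by a
finite window. -/
theorem exists_window_preimage {d : ℕ} {T : Type w} {S : Type u}
    {φ : Config d T → Config d S} (hφ : ∀ u y, φ (shift u y) = shift u (φ y))
    {W : Finset (Fin d → ℤ)} {D : Set (Config d S)}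
    (hD : DependsOn (· ∈ D) (W : Set (Fin d → ℤ))) {y : Config d T}
    (hy : ∀ w, codingRadius φ (shift w y) < ⊤) :
    ∃ R : ℕ, ∀ y' : Config d T, (∀ v ∈ box d R, y' v = y v) → (φ y' ∈ D ↔ φ y ∈ D) := by
  choose r hr using fun w => exists_of_codingRadius_lt_top (hy w)
  obtain ⟨k, hk⟩ := exists_subset_box W
  refine ⟨W.sup r + k, fun y' hy' => (hD fun w hw => ?_).to_iff⟩
  have hw' : ∀ z, φ z w = φ (shift w z) 0 := fun z => by simp [hφ, shift]
  rw [hw', hw']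
  refine hr w _ fun v hv => hy' _ (add_mem_box (mem_box.2 fun i => ?_) (hk hw))
  exact (natAbs_le_latticeNorm v i).trans (hv.trans (Finset.le_sup (f := r) hw))

/-- For a finitary factor of an i.i.d. process, the probability that a local event occurs in a
large box with a frequency exceeding its probability by a fixed amount is exponentially small in
the volume. -/
theorem IsFFIID.exists_exp_bound_occurrences {d : ℕ} {S : Type u} [MeasurableSpace S]
    {μ : Measure (Config d S)} (h : IsFFIID.{u, w} μ) {W : Finset (Fin d → ℤ)}
    {D : Set (Config d S)} (hDm : MeasurableSet D)
    (hD : DependsOn (· ∈ D) (W : Set (Fin d → ℤ))) {θ : ℝ} (hθ : μ.real D < θ) :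
    ∃ c : ℝ, 0 < c ∧ ∀ n, μ {x | θ * (box d n).card ≤ occurrences D n x} ≤
      ENNReal.ofReal (Real.exp (-(c * (box d n).card))) := by
  obtain ⟨T, _, ρ, _, φ, hφ, hfin⟩ := h
  have hinv := isTranslationInvariant_iidLaw (d := d) ρ
  set E := φ ⁻¹' D
  have hE : MeasurableSet E := hφ.measurable hDm
  have hEμ : (iidLaw d ρ).real E = μ.real D := by
    rw [← hφ.map_eq, map_measureReal_apply hφ.measurable hDm]
  have hfin' : ∀ᵐ y ∂iidLaw d ρ, ∃ R : ℕ, ∀ y' : Config d T,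
      (∀ v ∈ box d R, y' v = y v) → (y' ∈ E ↔ y ∈ E) := by
    have : ∀ᵐ y ∂iidLaw d ρ, ∀ w, codingRadius φ (shift w y) < ⊤ :=
      ae_all_iff.2 fun w => (hinv.measurePreserving w).quasiMeasurePreserving.ae hfin
    exact this.mono fun y hy => exists_window_preimage hφ.equivariant hD hy
  obtain ⟨R, G, hGm, hG, hEG, hGθ⟩ :=
    exists_local_ae_superset ρ hE hfin' (δ := θ) (by rwa [hEμ])
  obtain ⟨c, hc, hbound⟩ := _root_.exists_exp_bound_occurrences ρ hGm hG hGθ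
  refine ⟨c, hc, fun n => ?_⟩
  refine le_trans ?_ (hbound n)
  rw [← hφ.map_eq, Measure.map_apply hφ.measurable
    (measurableSet_le measurable_const (measurable_occurrences hDm n))]
  have hEG' : ∀ᵐ y ∂iidLaw d ρ, ∀ v : Fin d → ℤ, shift v y ∈ E → shift v y ∈ G :=
    ae_all_iff.2 fun v => (hinv.measurePreserving v).quasiMeasurePreserving.ae hEG
  refine measure_mono_ae (hEG'.mono fun y hy hyn => ?_)
  refine le_trans (Set.mem_ofPred.1 hyn) (Finset.sum_le_sum fun v _ => ?_)
  classical
  have : shift v (φ y) ∈ D → shift v y ∈ G := fun hv =>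
    hy v (by rwa [Set.mem_preimage, hφ.equivariant])
  simp only [Set.indicator_apply, Pi.one_apply]
  split_ifs <;> simp_all

/-! ### Comparison of fields with the same specification -/

theorem finite_outerBoundary_box (d n : ℕ) :
    (outerBoundary (box d n : Set (Fin d → ℤ))).Finite := by
  refine (box d (1 + n)).finite_toSet.subset ?_
  rintro u ⟨-, v, hv, huv⟩
  have h1 : u - v ∈ box d 1 := mem_box.2 fun i => huv ▸ natAbs_le_latticeNorm (u - v) i
  simpa using add_mem_box h1 hv

theorem occurrences_congr {d : ℕ} {S : Type u} {k n : ℕ} {W : Finset (Fin d → ℤ)}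
    (hW : W ⊆ box d k) (hkn : k ≤ n) {D : Set (Config d S)}
    (hD : DependsOn (· ∈ D) (W : Set (Fin d → ℤ)))
    {x y : Config d S} (hxy : ∀ v ∈ box d n, x v = y v) :
    occurrences D (n - k) x = occurrences D (n - k) y := by
  classical
  refine Finset.sum_congr rfl fun v hv => ?_
  have : (shift v x ∈ D) = (shift v y ∈ D) := hD fun w hw => hxy _ <| by
    simpa [Nat.add_sub_cancel' hkn] using add_mem_box (hW hw) hv
  simp only [Set.indicator_apply, this, Pi.one_apply]

/-- Almost every configuration belongs to the topological support. -/
theorem ae_mem_topSupport {d : ℕ} {S : Type u} [Finite S] [MeasurableSpace S]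
    (μ : Measure (Config d S)) : ∀ᵐ x ∂μ, x ∈ topSupport μ := by
  refine ae_all_iff.2 fun V => ?_
  have hnull : μ (⋃ τ ∈ {τ : ↥(V : Set (Fin d → ℤ)) → S |
      μ {x | restrictTo (V : Set (Fin d → ℤ)) x = τ} = 0},
        {x | restrictTo (V : Set (Fin d → ℤ)) x = τ}) = 0 :=
    (measure_biUnion_null_iff (Set.to_countable _)).2 fun τ hτ => hτ
  filter_upwards [measure_eq_zero_iff_ae_notMem.1 hnull] with x hx
  rw [pos_iff_ne_zero]
  intro h0
  refine hx (Set.mem_biUnion (x := restrictTo (V : Set (Fin d → ℤ)) x) ?_ rfl)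
  refine measure_mono_null (fun y hy => ?_) h0
  exact fun v hv => congrFun hy ⟨v, hv⟩

section Field

variable {d : ℕ} {S : Type u} [Finite S] [MeasurableSpace S] [DiscreteMeasurableSpace S]

theorem measurableSet_restrictTo_preimage {W : Set (Fin d → ℤ)} (hW : W.Finite)
    (A : Set (W → S)) : MeasurableSet {x : Config d S | restrictTo W x ∈ A} := by
  have := hW.to_subtype
  exact measurable_restrictTo W (Set.toFinite A).measurableSet

/-- Distinct laws differ on a local event; passing to the complement, the sign of the difference
can be prescribed. -/
theorem exists_local_measureReal_lt {μ ν : Measure (Config d S)} [IsProbabilityMeasure μ]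
    [IsProbabilityMeasure ν] (hne : μ ≠ ν) :
    ∃ (W : Finset (Fin d → ℤ)) (D : Set (Config d S)), MeasurableSet D ∧
      DependsOn (· ∈ D) (W : Set (Fin d → ℤ)) ∧ μ.real D < ν.real D := by
  obtain ⟨W, A, hA⟩ : ∃ (W : Finset (Fin d → ℤ)) (A : Set (W → S)),
      μ.real (W.restrict ⁻¹' A) ≠ ν.real (W.restrict ⁻¹' A) := by
    by_contra! hcon
    refine hne (IsProjectiveLimit.unique (P := fun I : Finset (Fin d → ℤ) => ν.map I.restrict)
      (fun I => Measure.ext fun A hA => ?_) fun I => rfl)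
    rw [Measure.map_apply (Finset.measurable_restrict I) hA,
      Measure.map_apply (Finset.measurable_restrict I) hA]
    exact (measureReal_eq_measureReal_iff).1 (hcon I A)
  have hm : MeasurableSet (W.restrict ⁻¹' A : Set (Config d S)) :=
    Finset.measurable_restrict W (Set.toFinite A).measurableSet
  have hdep : ∀ B : Set (W → S),
      DependsOn (· ∈ (W.restrict ⁻¹' B : Set (Config d S))) (W : Set (Fin d → ℤ)) := by
    intro B x y hxy
    have : W.restrict x = W.restrict y := funext fun v => hxy v v.2
    simp only [Set.mem_preimage, this]
  rcases lt_or_gt_of_ne hA with h | h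
  · exact ⟨W, _, hm, hdep A, h⟩
  · refine ⟨W, W.restrict ⁻¹' Aᶜ, hm.compl, hdep Aᶜ, ?_⟩
    rw [Set.preimage_compl, probReal_compl_eq_one_sub hm, probReal_compl_eq_one_sub hm]
    linarith

/-- The law of total probability as an inequality: a lower bound on the conditional probability of
`U` given each value `τ ∈ A` of a finite part of the configuration. -/
theorem mul_measureReal_le_of_forall_inter {μ : Measure (Config d S)} [IsProbabilityMeasure μ]
    {W : Set (Fin d → ℤ)} (hW : W.Finite) {U : Set (Config d S)} (A : Set (W → S)) {q : ℝ}
    (hq : ∀ τ ∈ A, q * μ.real {x | restrictTo W x = τ} ≤ μ.real ({x | restrictTo W x = τ} ∩ U)) :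
    q * μ.real {x | restrictTo W x ∈ A} ≤ μ.real U := by
  classical
  have := hW.to_subtype
  have hAf := Set.toFinite A
  set F := hAf.toFinset
  have hm : ∀ τ : W → S, MeasurableSet {x : Config d S | restrictTo W x = τ} := fun τ =>
    measurableSet_restrictTo_preimage hW {τ}
  have hdisj : (F : Set (W → S)).PairwiseDisjoint fun τ => {x : Config d S | restrictTo W x = τ} :=
    fun τ _ τ' _ hne => Set.disjoint_left.2 fun x hx hx' => hne (hx.symm.trans hx')
  have hA : {x : Config d S | restrictTo W x ∈ A} = ⋃ τ ∈ F, {x | restrictTo W x = τ} := by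
    ext x
    simp [F]
  have hsum : ∑ τ ∈ F, μ.real ({x | restrictTo W x = τ} ∩ U) ≤ μ.real U := by
    have h1 : ∀ τ, μ.real ({x | restrictTo W x = τ} ∩ U) =
        (μ.restrict U).real {x | restrictTo W x = τ} := fun τ => by
      rw [measureReal_restrict_apply (hm τ)]
    simp only [h1]
    rw [← measureReal_biUnion_finset hdisj fun τ _ => hm τ, measureReal_restrict_apply
      (F.measurableSet_biUnion fun τ _ => hm τ)]
    exact measureReal_mono Set.inter_subset_right
  rw [hA, measureReal_biUnion_finset hdisj fun τ _ => hm τ, Finset.mul_sum]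
  exact (Finset.sum_le_sum fun τ hτ => hq τ (hAf.mem_toFinset.1 hτ)).trans hsum

/-- An event inside the finite set `V` that is likely for `ν` cannot be much less likely for `μ`
than the boundary conditions typical of `ν`, if the two fields have the same specification: take
for `A` the boundary conditions under which `U` has conditional probability at least `1 / 2`. -/
theorem SameSpecification.exists_feasible {μ ν : Measure (Config d S)} [IsProbabilityMeasure μ]
    [IsProbabilityMeasure ν] (hspec : SameSpecification μ ν) {V : Finset (Fin d → ℤ)}
    (hV : (outerBoundary (V : Set (Fin d → ℤ))).Finite) {U : Set (Config d S)}
    (hU : DependsOn (· ∈ U) (V : Set (Fin d → ℤ))) :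
    ∃ A ⊆ feasible μ (outerBoundary (V : Set (Fin d → ℤ))),
      1 - 2 * ν.real Uᶜ ≤ ν.real {x | restrictTo (outerBoundary (V : Set (Fin d → ℤ))) x ∈ A} ∧
      μ.real {x | restrictTo (outerBoundary (V : Set (Fin d → ℤ))) x ∈ A} ≤ 2 * μ.real U := by
  classical
  set b := outerBoundary (V : Set (Fin d → ℤ))
  set U' : Set (↥(V : Set (Fin d → ℤ)) → S) := restrictTo (V : Set (Fin d → ℤ)) '' U
  have hU'm : MeasurableSet U' := (Set.toFinite U').measurableSet
  have hUU' : restrictTo (V : Set (Fin d → ℤ)) ⁻¹' U' = U := by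
    ext x
    refine ⟨?_, fun hx => ⟨x, hx, rfl⟩⟩
    rintro ⟨y, hy, hyx⟩
    exact (hU fun v hv => congrFun hyx ⟨v, hv⟩).mp hy
  have hUm : MeasurableSet U := hUU' ▸ measurable_restrictTo _ hU'm
  have hbm : ∀ τ : b → S, MeasurableSet {x : Config d S | restrictTo b x = τ} := fun τ =>
    measurableSet_restrictTo_preimage hV {τ}
  have hcond : ∀ (κ : Measure (Config d S)) [IsProbabilityMeasure κ] (τ : b → S),
      κ.real ({x | restrictTo b x = τ} ∩ U) =
        (specification κ V τ).real U' * κ.real {x | restrictTo b x = τ} := by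
    intro κ _ τ
    rw [specification, map_measureReal_apply (measurable_restrictTo _) hU'm, hUU', measureReal_def,
      measureReal_def, measureReal_def, ← ENNReal.toReal_mul,
      cond_mul_eq_inter (hbm τ)]
  refine ⟨{τ ∈ feasible μ b | 1 / 2 ≤ (specification μ V τ).real U'}, fun τ hτ => hτ.1, ?_, ?_⟩
  · set A := {τ ∈ feasible μ b | 1 / 2 ≤ (specification μ V τ).real U'}
    set A' := {τ ∈ feasible μ b | ¬ 1 / 2 ≤ (specification μ V τ).real U'}
    have h1 : 1 / 2 * ν.real {x | restrictTo b x ∈ A'} ≤ ν.real Uᶜ := by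
      refine mul_measureReal_le_of_forall_inter hV A' fun τ hτ => ?_
      have h2 := hcond ν τ
      rw [← (hspec V).2 τ hτ.1] at h2
      have h3 := measureReal_inter_add_sdiff (μ := ν)
        (s := {x : Config d S | restrictTo b x = τ}) hUm
      rw [← Set.sdiff_eq]
      have h4 := mul_le_mul_of_nonneg_right (not_le.1 hτ.2).le
        (measureReal_nonneg (μ := ν) (s := {x | restrictTo b x = τ}))
      linarith
    have h2 : 1 ≤ ν.real {x | restrictTo b x ∈ A} + ν.real {x | restrictTo b x ∈ A'} := by
      have hae : {x | restrictTo b x ∈ A} ∪ {x | restrictTo b x ∈ A'} ∈ ae ν := by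
        filter_upwards [ae_mem_topSupport ν] with x hx
        have hxb : restrictTo b x ∈ feasible μ b := (hspec V).1 ▸ ⟨x, hx, rfl⟩
        by_cases hxA : 1 / 2 ≤ (specification μ V (restrictTo b x)).real U'
        · exact Or.inl ⟨hxb, hxA⟩
        · exact Or.inr ⟨hxb, hxA⟩
      have h3 : ν.real ({x | restrictTo b x ∈ A} ∪ {x | restrictTo b x ∈ A'}) = 1 := by
        rw [measureReal_def, measure_congr (Filter.eventuallyEq_univ.2 hae), measure_univ,
          ENNReal.toReal_one]
      rw [← h3]
      exact measureReal_union_le _ _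
    linarith
  · have h1 := mul_measureReal_le_of_forall_inter (μ := μ) hV (U := U) (q := 1 / 2)
      {τ ∈ feasible μ b | 1 / 2 ≤ (specification μ V τ).real U'} fun τ hτ => by
        rw [hcond μ τ]
        exact mul_le_mul_of_nonneg_right hτ.2 measureReal_nonneg
    linarith

end Field

/-! ### Finitary factors and distinct fields with the same specification -/

theorem theorem1p3 (d : ℕ) (hd : 1 ≤ d)
    (S : Type u) [Finite S] [MeasurableSpace S] [DiscreteMeasurableSpace S]
    (μ ν : Measure (Config d S)) [IsProbabilityMeasure μ] [IsProbabilityMeasure ν]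
    (hμ : IsMarkovRandomField μ) (hν : IsMarkovRandomField ν)
    (hμ_erg : IsErgodicField μ) (hν_erg : IsErgodicField ν)
    (hne : μ ≠ ν) (hspec : SameSpecification μ ν)
    (ε : ℝ) (hε : 0 < ε)
    (g : ℕ → ℝ) (hg : g =o[atTop] fun n : ℕ => (n : ℝ) ^ d)
    (hbound : ∀ᶠ n : ℕ in atTop,
      ∀ A : Set (outerBoundary (box d n : Set (Fin d → ℤ)) → S),
        A ⊆ feasible μ (outerBoundary (box d n : Set (Fin d → ℤ))) →
        1 - ε ≤ ν.real {x | restrictTo (outerBoundary (box d n : Set (Fin d → ℤ))) x ∈ A} →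
        Real.exp (-g n) ≤
          μ.real {x | restrictTo (outerBoundary (box d n : Set (Fin d → ℤ))) x ∈ A}) :
    ¬ IsFFIID.{u, w} μ := by
  intro hff
  obtain ⟨W, D, hDm, hD, hlt⟩ := exists_local_measureReal_lt hne
  obtain ⟨θ, hμθ, hθν⟩ := exists_between hlt
  obtain ⟨c, hc, hexp⟩ := hff.exists_exp_bound_occurrences hDm hD hμθ
  obtain ⟨k, hk⟩ := exists_subset_box W
  -- The frequency of `D` in the box of radius `n - k` is a function of the box of radius `n`.
  let U : ℕ → Set (Config d S) := fun n =>
    {x | θ * (box d (n - k)).card < occurrences D (n - k) x}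
  have hνU : ∀ᶠ n in atTop, 2 * ν.real (U n)ᶜ < ε := by
    have h1 := (hν_erg.tendsto_occurrences_le hDm hθν).comp (tendsto_sub_atTop_nat k)
    have h2 := (ENNReal.tendsto_toReal ENNReal.zero_ne_top).comp h1
    filter_upwards [h2.eventually (gt_mem_nhds (show (0 : ENNReal).toReal < ε / 2 by simpa))]
      with n hn
    have h3 : (U n)ᶜ = {x | occurrences D (n - k) x ≤ θ * (box d (n - k)).card} := by
      ext x
      simp [U]
    rw [h3, measureReal_def]
    simp only [Function.comp_apply] at hn
    linarith
  have hμU : ∀ n, μ.real (U n) ≤ Real.exp (-(c * (box d (n - k)).card)) := fun n => by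
    refine ENNReal.toReal_le_of_le_ofReal (Real.exp_pos _).le ?_
    exact (measure_mono fun x hx => (Set.mem_ofPred.1 hx).le).trans (hexp (n - k))
  have hlower : ∀ᶠ n in atTop, Real.exp (-g n) ≤
      2 * Real.exp (-(c * (box d (n - k)).card)) := by
    filter_upwards [hbound, hνU, eventually_ge_atTop k] with n hn hνn hkn
    have hUdep : DependsOn (· ∈ U n) (box d n : Set (Fin d → ℤ)) := fun x y hxy => by
      simp only [U, Set.mem_ofPred_eq, occurrences_congr hk hkn hD hxy]
    obtain ⟨A, hA, hAν, hAμ⟩ := hspec.exists_feasible (finite_outerBoundary_box d n) hUdep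
    exact (hn A hA (by linarith)).trans (hAμ.trans (by linarith [hμU n]))
  have hpow : Tendsto (fun n : ℕ => (n : ℝ) ^ d) atTop atTop :=
    (tendsto_pow_atTop (by omega)).comp tendsto_natCast_atTop_atTop
  -- For `n ≥ 2 k` the box of radius `n - k` has more than `n ^ d` points.
  obtain ⟨n, h1, h2, h3, h4⟩ := (hlower.and ((hg.def (half_pos hc)).and
    ((hpow.eventually_gt_atTop (2 * Real.log 2 / c)).and (eventually_ge_atTop (2 * k))))).exists
  have hcard : (n : ℝ) ^ d ≤ (box d (n - k)).card := by
    rw [card_box]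
    exact_mod_cast Nat.pow_le_pow_left (by omega) d
  have h5 : g n ≤ c / 2 * (n : ℝ) ^ d := by
    refine (le_abs_self _).trans ?_
    simpa using h2
  have h6 : -g n ≤ Real.log 2 - c * (box d (n - k)).card := by
    have := Real.log_le_log (Real.exp_pos _) h1
    rw [Real.log_exp, Real.log_mul two_ne_zero (Real.exp_pos _).ne', Real.log_exp] at this
    linarith
  have h7 := mul_le_mul_of_nonneg_left hcard hc.le
  rw [div_lt_iff₀ hc] at h3
  linarith
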